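/- Let $G$ be a second-countable locally compact Hausdorff topological groupoid with a continuous Haar system, with unit space $G^{(0)}$ and range and source maps $r,s$. For $u\in G^{(0)}$ let $G^u_u=r^{-1}(u)\cap s^{-1}(u)$ be the stabilizer group at $u$, a locally compact group in the relative topology, and let $\Delta_u$ be its modular function, normalized by $\beta(Et)=\Delta_u(t)\,\beta(E)$ for Borel $E\subseteq G^u_u$, $t\in G^u_u$ and any left Haar measure $\beta$ on $G^u_u$. Then there is a family $(\beta^u)_{u\in G^{(0)}}$, with $\beta^u$ a left Haar measure on $G^u_u$ for each $u$, such that for every continuous compactly supported function $f:G\to\mathbb{C}$ the map $$u\longmapsto \int_{G^u_u} f(t)\,\Delta_u(t)^{-1/2}\,d\beta^u(t)$$ from $G^{(0)}$ to $\mathbb{C}$ is Borel. -/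

import Mathlib

open CategoryTheory MeasureTheory
open scoped CompactlySupported

/-! A groupoid `G` is given here as a category `X` in which every arrow is invertible. The set of
elements of `G` is `Arrow X`, the unit space is `X`, and the product of composable elements is
composition in diagrammatic order, so that the range of an element `x` is `x.left`, its source is
`x.right`, and `x y` is defined when `x.right = y.left`. -/

namespace TopGroupoid

universe v u

/-- The composable pairs `(x, y)` of a groupoid. -/
structure ComposablePair (X : Type u) [Groupoid.{v} X] where
  {a : X}
  {b : X}
  {c : X}
  fst : a ⟶ b
  snd : b ⟶ c

/-- The composable pairs carry the relative topology of `G × G`. -/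
instance (X : Type u) [Groupoid.{v} X] [TopologicalSpace (Arrow X)] :
    TopologicalSpace (ComposablePair X) :=
  TopologicalSpace.induced (fun p => (Arrow.mk p.fst, Arrow.mk p.snd)) inferInstance

/-- A topological groupoid: range, source, inversion and product are continuous, and so is the
inclusion of the unit space. As `range (𝟙 u) = u`, the last condition makes `u ↦ 𝟙 u` a
homeomorphism of `X` onto the set of units with its relative topology. -/
class TopologicalGroupoid (X : Type u) [Groupoid.{v} X] [TopologicalSpace X]
    [TopologicalSpace (Arrow X)] : Prop where
  continuous_range : Continuous fun x : Arrow X => x.left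
  continuous_source : Continuous fun x : Arrow X => x.right
  continuous_unit : Continuous fun u : X => Arrow.mk (𝟙 u)
  continuous_inv : Continuous fun x : Arrow X => Arrow.mk (Groupoid.inv x.hom)
  continuous_mul : Continuous fun p : ComposablePair X => Arrow.mk (p.fst ≫ p.snd)

/-- The range fibre `G^u = r⁻¹(u)`: the arrows out of `u`, with their other end. -/
structure RangeFiber {X : Type u} [Groupoid.{v} X] (u : X) where
  {target : X}
  hom : u ⟶ target

namespace RangeFiber

variable {X : Type u} [Groupoid.{v} X]

/-- The inclusion of `G^u` in `G`. -/
def toArrow {u : X} (y : RangeFiber u) : Arrow X := Arrow.mk y.hom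

/-- Left translation `y ↦ x y` from `G^{s(x)}` to `G^{r(x)}`. -/
def translate {u w : X} (x : u ⟶ w) (y : RangeFiber w) : RangeFiber u := ⟨x ≫ y.hom⟩

variable [TopologicalSpace (Arrow X)]

/-- `G^u` carries the relative topology of `G`. -/
instance (u : X) : TopologicalSpace (RangeFiber u) :=
  TopologicalSpace.induced toArrow inferInstance

instance (u : X) : MeasurableSpace (RangeFiber u) := borel _

instance (u : X) : BorelSpace (RangeFiber u) := ⟨rfl⟩

end RangeFiber

/-- A continuous (left) Haar system: Radon measures `λ^u` with full support on the fibres `G^u`,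
such that `u ↦ ∫ f dλ^u` is continuous for `f ∈ C_c(G)`, and
`∫ f(x y) dλ^{s(x)}(y) = ∫ f(y) dλ^{r(x)}(y)` for all `x ∈ G` and `f ∈ C_c(G)`. (On a
second-countable locally compact Hausdorff space, a Borel measure that is finite on compact sets
is Radon.) -/
structure HaarSystem (X : Type u) [Groupoid.{v} X] [TopologicalSpace X]
    [TopologicalSpace (Arrow X)] where
  measure : ∀ u : X, Measure (RangeFiber u)
  finite_on_compacts : ∀ u, IsFiniteMeasureOnCompacts (measure u)
  full_support : ∀ u, (measure u).IsOpenPosMeasure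
  continuous_integral : ∀ f : C_c(Arrow X, ℂ), Continuous fun u => ∫ y, f y.toArrow ∂(measure u)
  left_invariant : ∀ (f : C_c(Arrow X, ℂ)) {u w : X} (x : u ⟶ w),
    ∫ y, f (y.translate x).toArrow ∂(measure w) = ∫ y, f y.toArrow ∂(measure u)

/-- The stabilizer `G^u_u`, the group of elements of `G` with range and source `u`. -/
def Stabilizer {X : Type u} [Groupoid.{v} X] (u : X) : Type v := u ⟶ u

namespace Stabilizer

variable {X : Type u} [Groupoid.{v} X]

instance (u : X) : Group (Stabilizer u) := inferInstanceAs (Group (u ⟶ u))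

/-- The inclusion of `G^u_u` in `G`. -/
def toArrow {u : X} (t : Stabilizer u) : Arrow X := Arrow.mk (show u ⟶ u from t)

theorem injective_toArrow (u : X) : Function.Injective (toArrow (u := u)) :=
  Arrow.mk_injective u u

theorem range_toArrow (u : X) :
    Set.range (toArrow (u := u)) = {x : Arrow X | x.left = u} ∩ {x : Arrow X | x.right = u} := by
  ext x
  constructor
  · rintro ⟨t, rfl⟩
    exact ⟨rfl, rfl⟩
  · obtain ⟨a, b, g, rfl⟩ := Arrow.mk_surjective x
    rintro ⟨h1, h2⟩
    change a = u at h1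
    change b = u at h2
    subst h1
    subst h2
    exact ⟨g, rfl⟩

variable [TopologicalSpace (Arrow X)]

/-- `G^u_u` carries the relative topology of `G`. -/
instance (u : X) : TopologicalSpace (Stabilizer u) :=
  TopologicalSpace.induced toArrow inferInstance

instance (u : X) : MeasurableSpace (Stabilizer u) := borel _

instance (u : X) : BorelSpace (Stabilizer u) := ⟨rfl⟩

theorem isInducing_toArrow (u : X) : Topology.IsInducing (toArrow (u := u)) := ⟨rfl⟩

variable [TopologicalSpace X] [TopologicalGroupoid X]

instance (u : X) : IsTopologicalGroup (Stabilizer u) where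
  continuous_mul := by
    rw [(isInducing_toArrow u).continuous_iff]
    have h : Continuous fun p : Stabilizer u × Stabilizer u =>
        (ComposablePair.mk (show u ⟶ u from p.1) (show u ⟶ u from p.2) : ComposablePair X) := by
      rw [continuous_induced_rng]
      exact ((isInducing_toArrow u).continuous.comp continuous_fst).prodMk
        ((isInducing_toArrow u).continuous.comp continuous_snd)
    exact TopologicalGroupoid.continuous_mul.comp h
  continuous_inv := by
    rw [(isInducing_toArrow u).continuous_iff]
    exact TopologicalGroupoid.continuous_inv.comp (isInducing_toArrow u).continuous

theorem isClosedEmbedding_toArrow [T2Space (Arrow X)] (u : X) :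
    Topology.IsClosedEmbedding (toArrow (u := u)) := by
  have : T2Space X := T2Space.of_injective_continuous
    (f := fun u : X => Arrow.mk (𝟙 u))
    (fun a b h => congrArg (fun x : Arrow X => x.left) h) TopologicalGroupoid.continuous_unit
  refine ⟨⟨isInducing_toArrow u, injective_toArrow u⟩, ?_⟩
  rw [range_toArrow]
  exact (isClosed_singleton.preimage TopologicalGroupoid.continuous_range).inter
    (isClosed_singleton.preimage TopologicalGroupoid.continuous_source)

instance [T2Space (Arrow X)] [LocallyCompactSpace (Arrow X)] (u : X) :
    LocallyCompactSpace (Stabilizer u) :=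
  (isClosedEmbedding_toArrow u).locallyCompactSpace

end Stabilizer

/-- The modular function `Δ` of a locally compact group, with the usual normalization
`β(E t) = Δ(t) β(E)`, equivalently `∫ f(s t) dβ(s) = Δ(t)⁻¹ ∫ f(s) dβ(s)`, for one and hence every
left Haar measure `β`. Mathlib's `modularCharacter t` compares `β(E t⁻¹)` with `β(E)` instead, and
so is the inverse of this. -/
noncomputable def modularFunction {H : Type*} [Group H] [TopologicalSpace H]
    [IsTopologicalGroup H] [LocallyCompactSpace H] (t : H) : ℝ :=
  (Measure.modularCharacter t : ℝ)⁻¹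

/-- The normalization of the modular function: `β(E t) = Δ(t) β(E)`. -/
theorem measure_mul_right {H : Type*} [Group H] [TopologicalSpace H]
    [IsTopologicalGroup H] [LocallyCompactSpace H] [MeasurableSpace H] [BorelSpace H]
    (β : Measure H) [β.IsHaarMeasure] [β.InnerRegular] (t : H) (E : Set H) :
    β ((fun s => s * t) '' E) = ENNReal.ofReal (modularFunction t) * β E := by
  have h := Measure.map_right_mul_eq_modularCharacterFun_smul β t⁻¹
  have h2 : β.map (fun s => s * t⁻¹) E = β ((fun s => s * t) '' E) := by
    have := (Homeomorph.mulRight t⁻¹).toMeasurableEquiv.map_apply (μ := β) E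
    have e : (fun s => s * t) '' E = (fun s => s * t⁻¹) ⁻¹' E := by
      ext s
      constructor
      · rintro ⟨x, hx, rfl⟩
        simpa using hx
      · intro hs
        exact ⟨s * t⁻¹, hs, by simp⟩
    rw [e]
    exact this
  rw [← h2, h]
  have h3 : Measure.modularCharacter t⁻¹ = (Measure.modularCharacter t)⁻¹ := by
    apply eq_inv_of_mul_eq_one_left
    rw [← map_mul, inv_mul_cancel, map_one]
  change (Measure.modularCharacter t⁻¹ • β) E = _
  rw [h3, modularFunction, ← NNReal.coe_inv, ENNReal.ofReal_coe_nnreal]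
  rfl

end TopGroupoid

open TopGroupoid

/-!
The Haar system itself produces Haar measures of the stabilizers. The group `H = G^u_u` acts on
the range fibre `G^u` by left translation, properly, and this preserves `λ^u` and the source map.
Hence `λ^u` weighted by a function of the source is still `H`-invariant. If the weights `ψ n (u, ·)`
are supported in neighbourhoods of `u` shrinking to `{u}`, the weighted measures concentrate on the
orbit `H` of the unit, and after normalization they converge to a Haar measure of `H`
(`ConcentratesOn.tendsto_integral_div`). So for `f, g ∈ C_c(G)` with `g ≥ 0`, `g(u) > 0`, the ratio
`∫ f dβ / ∫ g dβ`, for any Haar measure `β` of `H`, is the limit of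

  `∫ f(y) ψ n (r(y), s(y)) dλ^u(y) / ∫ g(y) ψ n (r(y), s(y)) dλ^u(y)`.

Here numerator and denominator are continuous in `u`, because `f · ψ n ∘ (r, s)` and
`g · ψ n ∘ (r, s)` are again in `C_c(G)`. Normalizing the `β^u` by countably many such `g`,
chosen in a Borel way, gives a Borel family of Haar measures (`HaarSystem.exists_measurable_haar`).

The convergence is a variant of the proof of uniqueness of Haar measure. For an `H`-invariant
measure `m` on `G^u`, Fubini gives `m(f R) = m(g F_f)` with `R(y) = ∫ g(t⁻¹ y) dβ(t)` and
`F_f(y) = ∫ f(t y) dβ(t)`. On the orbit, `R` is constant and `F_f` is the modular character times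
`∫ f dβ`; functions which vanish on the orbit do not contribute in the limit, since every `m(f)` is
dominated by a multiple of `m(g)`.

Finally, the `β^u` form an s-finite kernel from the unit space to `G`, and the modular character at
`t ∈ G^u_u` is `∫ g(s t) dβ^u(s)` if `∫ g dβ^u = 1`, so that it is a Borel function of `t` in the
isotropy bundle (`HaarSystem.exists_measurable_haar_modularCharacter`). Integrals of Borel functions
against a kernel are Borel.
-/

open Filter Topology Set
open scoped NNReal

/-! ### Invariant measures concentrating on an orbit -/

namespace MeasureTheory

/-- The measures `m i` concentrate on the set `S` along `l`: every compact set disjoint from `S`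
is eventually null. -/
def ConcentratesOn {ι Y : Type*} [TopologicalSpace Y] [MeasurableSpace Y]
    (m : ι → Measure Y) (l : Filter ι) (S : Set Y) : Prop :=
  ∀ K : Set Y, IsCompact K → Disjoint K S → ∀ᶠ i in l, m i K = 0

section Orbit

variable {ι H Y : Type*} [Group H] [TopologicalSpace H] [TopologicalSpace Y] [MulAction H Y]
  [ProperSMul H Y]

theorem _root_.MulAction.isClosed_orbit_of_properSMul (e : Y) :
    IsClosed (MulAction.orbit H e) := by
  have h := (isClosed_univ (X := H)).smul_right_of_isCompact (isCompact_singleton (x := e))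
  convert h using 1
  ext y
  simp [MulAction.mem_orbit_iff]

theorem _root_.ProperSMul.exists_isCompact_of_smul_mem {K L : Set Y} (hK : IsCompact K)
    (hL : IsCompact L) : ∃ C : Set H, IsCompact C ∧ ∀ t : H, ∀ y ∈ K, t • y ∈ L → t ∈ C :=
  ⟨_, ProperSMul.isCompact_setOfPred_inter_nonempty hK hL,
    fun t y hy hty => ⟨t • y, Set.smul_mem_smul_set hy, hty⟩⟩

theorem _root_.HasCompactSupport.comp_orbitMap [IsTopologicalGroup H] {k : Y → ℝ}
    (hk : HasCompactSupport k) (e : Y) : HasCompactSupport fun t : H => k (t • e) := by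
  obtain ⟨C, hC, hCK⟩ :=
    ProperSMul.exists_isCompact_of_smul_mem (H := H) (isCompact_singleton (x := e)) hk
  refine HasCompactSupport.of_support_subset_isCompact hC fun t ht => ?_
  exact hCK t e rfl (subset_tsupport k ht)

variable [MeasurableSpace H] [BorelSpace H]

/-- Averaging over the group preserves continuity. -/
theorem continuous_integral_smul [LocallyCompactSpace Y] (β : Measure H)
    [IsFiniteMeasureOnCompacts β] {k : Y → ℝ} (hk : Continuous k)
    (hks : HasCompactSupport k) :
    Continuous fun y => ∫ t, k (t • y) ∂β := by
  refine continuous_iff_continuousAt.2 fun y => ?_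
  obtain ⟨N, hN, hyN⟩ := exists_compact_mem_nhds y
  obtain ⟨C, hC, hCK⟩ := ProperSMul.exists_isCompact_of_smul_mem (H := H) hN hks
  refine ContinuousOn.continuousAt (s := N) ?_ hyN
  refine continuousOn_integral_of_compact_support hC
    (Continuous.continuousOn (hk.comp (continuous_snd.smul continuous_fst))) ?_
  intro z t hz ht
  by_contra hne
  exact ht (hCK t z hz (subset_tsupport k hne))

theorem continuous_integral_inv_smul [IsTopologicalGroup H] [LocallyCompactSpace Y]
    (β : Measure H) [IsFiniteMeasureOnCompacts β] {k : Y → ℝ} (hk : Continuous k)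
    (hks : HasCompactSupport k) :
    Continuous fun y => ∫ t, k (t⁻¹ • y) ∂β := by
  refine continuous_iff_continuousAt.2 fun y => ?_
  obtain ⟨N, hN, hyN⟩ := exists_compact_mem_nhds y
  obtain ⟨C, hC, hCK⟩ := ProperSMul.exists_isCompact_of_smul_mem (H := H) hN hks
  refine ContinuousOn.continuousAt (s := N) ?_ hyN
  refine continuousOn_integral_of_compact_support hC.inv
    (Continuous.continuousOn (hk.comp (continuous_snd.inv.smul continuous_fst))) ?_
  intro z t hz ht
  by_contra hne
  exact ht (hCK t⁻¹ z hz (subset_tsupport k hne))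

variable [MeasurableSpace Y] [BorelSpace Y] {m : ι → Measure Y}
  [∀ i, IsFiniteMeasureOnCompacts (m i)] [∀ i, SMulInvariantMeasure H Y (m i)]
  {l : Filter ι} {e : Y}

/-- Finitely many translates of `{g > g e / 2}` cover the part of the support of `f` in the
orbit, and the rest of that support is eventually null. -/
theorem ConcentratesOn.exists_integral_le (hm : ConcentratesOn m l (MulAction.orbit H e))
    {f g : Y → ℝ} (hf : Continuous f) (hfs : HasCompactSupport f) (hg : Continuous g)
    (hgs : HasCompactSupport g) (hg0 : ∀ y, 0 ≤ g y) (hge : 0 < g e) :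
    ∃ C : ℝ, 0 ≤ C ∧ ∀ᶠ i in l, ∫ y, f y ∂(m i) ≤ C * ∫ y, g y ∂(m i) := by
  classical
  obtain ⟨M, hM⟩ := hfs.exists_bound_of_continuous hf
  have hM0 : 0 ≤ M := (norm_nonneg _).trans (hM e)
  have hcomp : IsCompact (tsupport f ∩ MulAction.orbit H e) :=
    hfs.isCompact.inter_right (MulAction.isClosed_orbit_of_properSMul e)
  let U : H → Set Y := fun t => {z | g e / 2 < g (t⁻¹ • z)}
  have hU : ∀ t, IsOpen (U t) := fun t =>
    isOpen_lt continuous_const (hg.comp (continuous_const_smul _))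
  obtain ⟨T, hT⟩ := hcomp.elim_finite_subcover U hU (by
    rintro _ ⟨-, t, rfl⟩
    refine mem_iUnion.2 ⟨t, ?_⟩
    simp only [U, mem_ofPred_eq, inv_smul_smul]
    linarith)
  have hnull := hm (tsupport f \ ⋃ t ∈ T, U t)
    (hfs.isCompact.diff (isOpen_biUnion fun t _ => hU t)) (by
      rw [Set.disjoint_left]
      rintro z ⟨hz, hzU⟩ hzo
      exact hzU (hT ⟨hz, hzo⟩))
  have hint : ∀ i, ∀ t : H, Integrable (fun z => 2 * M / g e * g (t⁻¹ • z)) (m i) := fun i t =>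
    ((hg.comp (continuous_const_smul t⁻¹)).integrable_of_hasCompactSupport
      (hgs.comp_homeomorph (Homeomorph.smul t⁻¹))).const_mul _
  refine ⟨T.card * (2 * M / g e), by positivity, hnull.mono fun i hi => ?_⟩
  calc ∫ y, f y ∂(m i)
      ≤ ∫ y, ∑ t ∈ T, 2 * M / g e * g (t⁻¹ • y) ∂(m i) := by
        refine integral_mono_ae (hf.integrable_of_hasCompactSupport hfs)
          (integrable_finsetSum _ fun t _ => hint i t) ?_
        filter_upwards [compl_mem_ae_iff.2 hi] with z hz
        have hnn : ∀ t ∈ T, 0 ≤ 2 * M / g e * g (t⁻¹ • z) := fun t _ =>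
          mul_nonneg (by positivity) (hg0 _)
        by_cases hzf : z ∈ tsupport f
        · obtain ⟨t, ht, hzt⟩ : ∃ t ∈ T, z ∈ U t := by
            by_contra hcon
            exact hz ⟨hzf, by simpa using hcon⟩
          refine le_trans ?_ (Finset.single_le_sum hnn ht)
          calc f z ≤ M := (le_abs_self _).trans (hM z)
            _ = 2 * M / g e * (g e / 2) := by field_simp
            _ ≤ _ := mul_le_mul_of_nonneg_left (le_of_lt hzt) (by positivity)
        · rw [image_eq_zero_of_notMem_tsupport hzf]
          exact Finset.sum_nonneg hnn
    _ = ∑ t ∈ T, 2 * M / g e * ∫ y, g y ∂(m i) := by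
        rw [integral_finsetSum _ fun t _ => hint i t]
        refine Finset.sum_congr rfl fun t _ => ?_
        rw [integral_const_mul, integral_smul_eq_self g]
    _ = T.card * (2 * M / g e) * ∫ y, g y ∂(m i) := by
        rw [Finset.sum_const, nsmul_eq_mul, mul_assoc]

variable [T2Space Y]

/-- Functions vanishing on the orbit are negligible in the limit. -/
theorem ConcentratesOn.tendsto_integral_div_zero [LocallyCompactSpace Y]
    (hm : ConcentratesOn m l (MulAction.orbit H e)) {k g : Y → ℝ} (hk : Continuous k)
    (hks : HasCompactSupport k) (hk0 : ∀ t : H, k (t • e) = 0) (hg : Continuous g)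
    (hgs : HasCompactSupport g) (hg0 : ∀ y, 0 ≤ g y) (hge : 0 < g e) :
    Tendsto (fun i => (∫ y, k y ∂(m i)) / ∫ y, g y ∂(m i)) l (𝓝 0) := by
  obtain ⟨χ, hχ1, -, hχs, hχI⟩ := exists_continuous_one_zero_of_isCompact hks.isCompact
    isClosed_empty (disjoint_empty _)
  obtain ⟨C, hC0, hC⟩ := hm.exists_integral_le χ.continuous hχs hg hgs hg0 hge
  rw [Metric.tendsto_nhds]
  intro ε hε
  let δ : ℝ := ε / (C + 1)
  have hδ : 0 < δ := by positivity
  have hclosed : IsClosed {y | δ ≤ |k y|} := isClosed_le continuous_const hk.abs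
  have hnull := hm (tsupport k ∩ {y | δ ≤ |k y|}) (hks.isCompact.inter_right hclosed) (by
    rw [Set.disjoint_left]
    rintro _ ⟨-, hy⟩ ⟨t, rfl⟩
    simp only [mem_ofPred_eq, hk0, abs_zero] at hy
    linarith)
  filter_upwards [hnull, hC] with i hi hCi
  have hgi : 0 ≤ ∫ y, g y ∂(m i) := integral_nonneg hg0
  have hle : |∫ y, k y ∂(m i)| ≤ δ * C * ∫ y, g y ∂(m i) :=
    calc |∫ y, k y ∂(m i)| ≤ ∫ y, |k y| ∂(m i) := abs_integral_le_integral_abs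
      _ ≤ ∫ y, δ * χ y ∂(m i) := by
        refine integral_mono_ae (hk.integrable_of_hasCompactSupport hks).abs
          ((χ.continuous.integrable_of_hasCompactSupport hχs).const_mul δ) ?_
        filter_upwards [compl_mem_ae_iff.2 hi] with z hz
        by_cases hzk : z ∈ tsupport k
        · rw [hχ1 hzk, Pi.one_apply, mul_one]
          by_contra hcon
          exact hz ⟨hzk, (not_le.1 hcon).le⟩
        · rw [image_eq_zero_of_notMem_tsupport hzk, abs_zero]
          exact mul_nonneg hδ.le (hχI z).1
      _ = δ * ∫ y, χ y ∂(m i) := integral_const_mul _ _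
      _ ≤ δ * (C * ∫ y, g y ∂(m i)) := mul_le_mul_of_nonneg_left hCi hδ.le
      _ = _ := (mul_assoc _ _ _).symm
  rw [dist_zero_right, Real.norm_eq_abs, abs_div, abs_of_nonneg hgi]
  calc _ ≤ δ * C := div_le_of_le_mul₀ hgi (by positivity) hle
    _ < δ * (C + 1) := by gcongr; linarith
    _ = ε := by simp only [δ]; field_simp

variable [IsTopologicalGroup H]

/-- Two ways of computing the double integral of `f y * g (t⁻¹ • y)`, by Fubini and the
invariance of `μ`. -/
theorem integral_mul_integral_inv_smul (β : Measure H) [IsFiniteMeasureOnCompacts β]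
    (μ : Measure Y) [IsFiniteMeasureOnCompacts μ] [SMulInvariantMeasure H Y μ] {f g : Y → ℝ}
    (hf : Continuous f) (hfs : HasCompactSupport f) (hg : Continuous g)
    (hgs : HasCompactSupport g) :
    ∫ y, f y * ∫ t, g (t⁻¹ • y) ∂β ∂μ = ∫ y, g y * ∫ t, f (t • y) ∂β ∂μ := by
  have hcs : ∀ {p q : Y → ℝ} (s : H → H), Continuous s → HasCompactSupport p →
      HasCompactSupport q → (∀ C : Set H, IsCompact C → IsCompact (s ⁻¹' C)) →
      HasCompactSupport (Function.uncurry fun y t => p y * q (s t • y)) := by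
    intro p q s hs hp hq hC
    obtain ⟨C, hCc, hCK⟩ := ProperSMul.exists_isCompact_of_smul_mem (H := H) hp hq
    refine HasCompactSupport.of_support_subset_isCompact (hp.isCompact.prod (hC C hCc)) ?_
    rintro ⟨y, t⟩ h
    have h1 := left_ne_zero_of_mul h
    have h2 := right_ne_zero_of_mul h
    exact ⟨subset_tsupport _ h1, hCK _ y (subset_tsupport _ h1) (subset_tsupport _ h2)⟩
  calc ∫ y, f y * ∫ t, g (t⁻¹ • y) ∂β ∂μ
      = ∫ y, ∫ t, f y * g (t⁻¹ • y) ∂β ∂μ := by simp_rw [integral_const_mul]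
    _ = ∫ t, ∫ y, f y * g (t⁻¹ • y) ∂μ ∂β := by
        refine integral_integral_swap_of_hasCompactSupport ?_
          (hcs _ continuous_inv hfs hgs fun C hC => hC.inv)
        exact (hf.comp continuous_fst).mul (hg.comp (continuous_snd.inv.smul continuous_fst))
    _ = ∫ t, ∫ y, g y * f (t • y) ∂μ ∂β := by
        refine integral_congr_ae (.of_forall fun t => ?_)
        -- substitute `t • y` for `y`
        simp only
        rw [← integral_smul_eq_self (μ := μ) (fun y => f y * g (t⁻¹ • y)) (g := t)]
        simp [mul_comm]
    _ = ∫ y, ∫ t, g y * f (t • y) ∂β ∂μ := by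
        refine (integral_integral_swap_of_hasCompactSupport ?_
          (hcs _ continuous_id hgs hfs fun C hC => hC)).symm
        exact (hg.comp continuous_fst).mul (hf.comp (continuous_snd.smul continuous_fst))
    _ = ∫ y, g y * ∫ t, f (t • y) ∂β ∂μ := by simp_rw [integral_const_mul]

variable [LocallyCompactSpace Y] [LocallyCompactSpace H]

/-- Right translation multiplies the Haar integral by a constant which does not depend on the
integrand. -/
theorem integral_mul_right_eq_modularCharacter_mul (β : Measure H) [β.IsHaarMeasure]
    {φ : H → ℝ} (hφ : Continuous φ) (hφs : HasCompactSupport φ) (h : H) :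
    ∫ t, φ (t * h) ∂β = Measure.modularCharacter h * ∫ t, φ t ∂β := by
  have h1 := Measure.integral_isMulLeftInvariant_eq_smul_of_hasCompactSupport
    (β.map (· * h)) β hφ hφs
  rw [integral_map (continuous_mul_const h).aemeasurable hφ.aestronglyMeasurable,
    integral_smul_nnreal_measure,
    ← Measure.modularCharacterFun_eq_haarScalarFactor β h] at h1
  rw [h1, NNReal.smul_def, smul_eq_mul]
  rfl

/-- Invariant measures which concentrate on the orbit of `e` converge, up to normalization, to
the image of Haar measure under the orbit map. -/
theorem ConcentratesOn.tendsto_integral_div (hm : ConcentratesOn m l (MulAction.orbit H e))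
    (β : Measure H) [β.IsHaarMeasure] {f g : Y → ℝ} (hf : Continuous f)
    (hfs : HasCompactSupport f) (hg : Continuous g) (hgs : HasCompactSupport g)
    (hg0 : ∀ y, 0 ≤ g y) (hge : 0 < g e) (hpos : ∀ᶠ i in l, 0 < ∫ y, g y ∂(m i)) :
    Tendsto (fun i => (∫ y, f y ∂(m i)) / ∫ y, g y ∂(m i)) l
      (𝓝 ((∫ t, f (t • e) ∂β) / ∫ t, g (t • e) ∂β)) := by
  let R : Y → ℝ := fun y => ∫ t, g (t⁻¹ • y) ∂β
  let F : (Y → ℝ) → Y → ℝ := fun k y => ∫ t, k (t • y) ∂β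
  have hR : Continuous R := continuous_integral_inv_smul β hg hgs
  have hF : ∀ {k : Y → ℝ}, Continuous k → HasCompactSupport k → Continuous (F k) :=
    fun hk hks => continuous_integral_smul β hk hks
  have hRe : ∀ h : H, R (h • e) = R e := by
    intro h
    have h1 := integral_mul_left_eq_self (μ := β) (fun t => g (t⁻¹ • h • e)) h
    simp only [mul_inv_rev, mul_smul, inv_smul_smul] at h1
    exact h1.symm
  have hFe : ∀ {k : Y → ℝ}, Continuous k → HasCompactSupport k → ∀ h : H,
      F k (h • e) = Measure.modularCharacter h * F k e := by
    intro k hk hks h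
    have h1 := integral_mul_right_eq_modularCharacter_mul β
      (hk.comp (continuous_id.smul continuous_const)) (hks.comp_orbitMap (H := H) e) h
    simpa [mul_smul] using h1
  have horb : Continuous fun t : H => t • e := continuous_id.smul continuous_const
  have hFge : 0 < F g e := by
    refine (hg.comp horb).integral_pos_of_hasCompactSupport_nonneg_nonzero (x := 1)
      (hgs.comp_orbitMap e) (fun t => hg0 _) ?_
    simpa using hge.ne'
  have hRpos : 0 < R e := by
    refine (hg.comp (horb.comp continuous_inv)).integral_pos_of_hasCompactSupport_nonneg_nonzero
      (x := 1) ((hgs.comp_orbitMap (H := H) e).comp_homeomorph (Homeomorph.inv H))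
      (fun t => hg0 _) ?_
    simpa using hge.ne'
  -- The integrands in `key` and `key2` vanish on the orbit, as `R` is constant there and `F f`,
  -- `F g` are proportional.
  have key : ∀ {k : Y → ℝ}, Continuous k → HasCompactSupport k →
      Tendsto (fun i => (∫ y, k y * (R y - R e) ∂(m i)) / ∫ y, g y ∂(m i)) l (𝓝 0) := by
    intro k hk hks
    refine hm.tendsto_integral_div_zero (H := H) (hk.mul (hR.sub continuous_const))
      hks.mul_right ?_ hg hgs hg0 hge
    intro t
    simp [hRe]
  have key2 : Tendsto (fun i => (∫ y, g y * (F g e * F f y - F f e * F g y) ∂(m i)) /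
      ∫ y, g y ∂(m i)) l (𝓝 0) := by
    refine hm.tendsto_integral_div_zero (H := H)
      (hg.mul ((continuous_const.mul (hF hf hfs)).sub (continuous_const.mul (hF hg hgs))))
      hgs.mul_right ?_ hg hgs hg0 hge
    intro t
    simp only [hFe hf hfs, hFe hg hgs]
    ring
  -- The ratio for `f`, solved for in the identity `m(k R) = m(g F_k)` with `k = f` and `k = g`.
  have expand : ∀ i, 0 < ∫ y, g y ∂(m i) →
      (∫ y, f y ∂(m i)) / ∫ y, g y ∂(m i) = F f e / F g e
        + (R e)⁻¹ * (F g e)⁻¹ * (((∫ y, g y * (F g e * F f y - F f e * F g y) ∂(m i)) /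
          ∫ y, g y ∂(m i)) - F g e * ((∫ y, f y * (R y - R e) ∂(m i)) / ∫ y, g y ∂(m i))
          + F f e * ((∫ y, g y * (R y - R e) ∂(m i)) / ∫ y, g y ∂(m i))) := by
    intro i hi
    have hint : ∀ {p q : Y → ℝ}, Continuous p → HasCompactSupport p → Continuous q →
        Integrable (fun y => p y * q y) (m i) := fun hp hps hq =>
      (hp.mul hq).integrable_of_hasCompactSupport hps.mul_right
    have e1 : ∀ {k : Y → ℝ}, Continuous k → HasCompactSupport k →
        ∫ y, k y * (R y - R e) ∂(m i) = (∫ y, g y * F k y ∂(m i)) - (∫ y, k y ∂(m i)) * R e := by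
      intro k hk hks
      rw [← integral_mul_integral_inv_smul β (m i) hk hks hg hgs, ← integral_mul_const,
        ← integral_sub (hint hk hks hR) (hint hk hks continuous_const)]
      simp_rw [mul_sub]
    have e2 : ∫ y, g y * (F g e * F f y - F f e * F g y) ∂(m i)
        = F g e * (∫ y, g y * F f y ∂(m i)) - F f e * ∫ y, g y * F g y ∂(m i) := by
      rw [← integral_const_mul, ← integral_const_mul, ← integral_sub
        ((hint hg hgs (hF hf hfs)).const_mul _) ((hint hg hgs (hF hg hgs)).const_mul _)]
      refine integral_congr_ae (.of_forall fun y => ?_)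
      simp only
      ring
    rw [e1 hf hfs, e1 hg hgs, e2]
    field_simp
    ring
  have lim := ((key2.sub ((key hf hfs).const_mul (F g e))).add
    ((key hg hgs).const_mul (F f e))).const_mul ((R e)⁻¹ * (F g e)⁻¹) |>.const_add (F f e / F g e)
  simp only [mul_zero, sub_zero, add_zero] at lim
  exact lim.congr' (hpos.mono fun i hi => (expand i hi).symm)

end Orbit

end MeasureTheory

/-! ### Kernels given by Radon measures -/

namespace ProbabilityTheory.Kernel

variable {α β : Type*} [MeasurableSpace α] [MeasurableSpace β]

/-- A kernel whose measures are finite, with no uniform bound on their masses, is s-finite. -/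
theorem isSFiniteKernel_of_forall_isFiniteMeasure (κ : Kernel α β)
    (h : ∀ a, IsFiniteMeasure (κ a)) : IsSFiniteKernel κ := by
  classical
  let r : α → ℕ := fun a => ⌊(κ a univ).toReal⌋₊
  have hr : Measurable r := Nat.measurable_floor.comp (κ.measurable_coe .univ).ennreal_toReal
  have hs : ∀ n, MeasurableSet (r ⁻¹' {n}) := fun n => hr (measurableSet_singleton n)
  have hsum : κ = Kernel.sum fun n => piecewise (hs n) κ 0 := by
    ext a s hms
    rw [Kernel.sum_apply' _ _ hms, tsum_eq_single (r a)]
    · simp [piecewise_apply']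
    · intro n hn
      simp [piecewise_apply', hn.symm]
  have hfin : ∀ n, IsFiniteKernel (piecewise (hs n) κ 0) := by
    intro n
    refine ⟨⟨n + 1, by finiteness, fun a => ?_⟩⟩
    rw [piecewise_apply']
    split_ifs with hn
    · have h1 : (κ a univ).toReal < n + 1 := by
        have h2 := Nat.lt_floor_add_one (κ a univ).toReal
        rwa [show ⌊(κ a univ).toReal⌋₊ = n from hn] at h2
      rw [← ENNReal.ofReal_toReal (measure_ne_top (κ a) univ)]
      refine (ENNReal.ofReal_le_ofReal h1.le).trans ?_
      rw [ENNReal.ofReal_add (by positivity) zero_le_one]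
      simp
    · simp
  rw [hsum]
  infer_instance

variable {G : Type*} [TopologicalSpace G] [T2Space G] [LocallyCompactSpace G]
  [SecondCountableTopology G] [MeasurableSpace G] [BorelSpace G]

theorem isSFiniteKernel_of_isFiniteMeasureOnCompacts (κ : Kernel α G)
    (h : ∀ a, IsFiniteMeasureOnCompacts (κ a)) : IsSFiniteKernel κ := by
  have hm : ∀ n, MeasurableSet (disjointed (compactCovering G) n) := fun n =>
    MeasurableSet.disjointed (fun i => (isCompact_compactCovering G i).measurableSet) n
  have hsum : κ = Kernel.sum fun n => κ.restrict (hm n) := by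
    ext1 a
    simp only [Kernel.sum_apply, Kernel.restrict_apply]
    rw [← Measure.restrict_iUnion (disjoint_disjointed _) hm, iUnion_disjointed,
      iUnion_compactCovering, Measure.restrict_univ]
  have hfin : ∀ n, IsSFiniteKernel (κ.restrict (hm n)) := by
    intro n
    refine isSFiniteKernel_of_forall_isFiniteMeasure _ fun a => ⟨?_⟩
    rw [Kernel.restrict_apply, Measure.restrict_apply_univ]
    exact (measure_mono (disjointed_subset _ n)).trans_lt
      (isCompact_compactCovering G n).measure_lt_top
  rw [hsum]
  infer_instance

end ProbabilityTheory.Kernel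

namespace MeasureTheory.Measure

variable {α G : Type*} [MeasurableSpace α] [TopologicalSpace G] [T2Space G]
  [LocallyCompactSpace G] [SecondCountableTopology G] [MeasurableSpace G] [BorelSpace G]

/-- A family of Radon measures is measurable as soon as its integrals of nonnegative continuous
functions with compact support are. -/
theorem measurable_of_measurable_integral {κ : α → Measure G}
    (hκ : ∀ a, IsFiniteMeasureOnCompacts (κ a))
    (h : ∀ f : G → ℝ, Continuous f → HasCompactSupport f → (∀ x, 0 ≤ f x) →
      Measurable fun a => ∫ x, f x ∂(κ a)) :
    Measurable κ := by
  have hopen : ∀ U : Set G, IsOpen U → Measurable fun a => κ a U := by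
    intro U hU
    have : LocallyCompactSpace U := hU.locallyCompactSpace
    let K : ℕ → Set G := fun n => Subtype.val '' compactCovering U n
    have hK : ∀ n, IsCompact (K n) := fun n =>
      (isCompact_compactCovering U n).image continuous_subtype_val
    have hKU : ⋃ n, K n = U := by
      simp only [K]
      rw [← image_iUnion, iUnion_compactCovering, image_univ, Subtype.range_coe]
    have hKmono : Monotone K := fun i j hij => image_mono (compactCovering_subset U hij)
    have hdisj : ∀ n, Disjoint (K n) Uᶜ := fun n =>
      disjoint_compl_right_iff_subset.2 (hKU ▸ subset_iUnion K n)
    choose f hf1 hf0 hfs hfI using fun n =>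
      exists_continuous_one_zero_of_isCompact (hK n) hU.isClosed_compl (hdisj n)
    have hsup : ∀ a, κ a U = ⨆ n, ENNReal.ofReal (∫ x, f n x ∂(κ a)) := by
      intro a
      have hli : ∀ n, ENNReal.ofReal (∫ x, f n x ∂(κ a)) = ∫⁻ x, ENNReal.ofReal (f n x) ∂(κ a) :=
        fun n => ofReal_integral_eq_lintegral_ofReal
          ((f n).continuous.integrable_of_hasCompactSupport (hfs n))
          (.of_forall fun x => (hfI n x).1)
      simp_rw [hli]
      refine le_antisymm ?_ (iSup_le fun n => ?_)
      · conv_lhs => rw [← hKU, hKmono.measure_iUnion]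
        refine iSup_mono fun n => ?_
        rw [← lintegral_indicator_one (hK n).measurableSet]
        refine lintegral_mono fun x => ?_
        by_cases hx : x ∈ K n
        · simp [hx, hf1 n hx]
        · simp [hx]
      · rw [← lintegral_indicator_one hU.measurableSet]
        refine lintegral_mono fun x => ?_
        by_cases hx : x ∈ U
        · simpa [hx] using (hfI n x).2
        · simp [hx, hf0 n hx]
    simp_rw [hsup]
    exact .iSup fun n => (h _ (f n).continuous (hfs n) fun x => (hfI n x).1).ennreal_ofReal
  -- Opens form a generating π-system, but `κ a` is only finite on relatively compact pieces `W n`.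
  let E : CompactExhaustion G := default
  let W : ℕ → Set G := fun n => interior (E n)
  have hWmono : Monotone W := fun i j hij => interior_mono (E.subset hij)
  have hWU : ⋃ n, W n = univ := by
    refine eq_univ_of_forall fun x => ?_
    obtain ⟨n, hn⟩ := E.exists_mem x
    exact mem_iUnion.2 ⟨n + 1, E.subset_interior_succ n hn⟩
  have hfin : ∀ n a, IsFiniteMeasure ((κ a).restrict (W n)) := fun n a => ⟨by
    rw [Measure.restrict_apply_univ]
    exact (measure_mono interior_subset).trans_lt (E.isCompact n).measure_lt_top⟩
  have hrestrict : ∀ n, Measurable fun a => (κ a).restrict (W n) := by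
    intro n
    refine Measurable.measure_of_isPiSystem (S := {s | IsOpen s}) (BorelSpace.measurable_eq)
      isPiSystem_isOpen (fun s hs => ?_) ?_
    · simp_rw [Measure.restrict_apply (IsOpen.measurableSet hs)]
      exact hopen _ (IsOpen.inter hs isOpen_interior)
    · simp_rw [Measure.restrict_apply_univ]
      exact hopen _ isOpen_interior
  refine Measure.measurable_of_measurable_coe _ fun s hs => ?_
  have hsup : ∀ a, κ a s = ⨆ n, (κ a).restrict (W n) s := by
    intro a
    simp_rw [Measure.restrict_apply hs]
    rw [← Monotone.measure_iUnion fun i j hij => inter_subset_inter_right s (hWmono hij),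
      ← inter_iUnion, hWU, inter_univ]
  simp_rw [hsup]
  exact .iSup fun n => (Measure.measurable_coe hs).comp (hrestrict n)

end MeasureTheory.Measure

/-! ### The stabilizer action on a range fibre -/

namespace TopGroupoid

universe v u

variable {X : Type u} [Groupoid.{v} X]

/-- The product of two composable arrows, with composability a proposition. -/
def comp (x y : Arrow X) (h : x.right = y.left) : Arrow X := Arrow.mk (x.hom ≫ eqToHom h ≫ y.hom)

theorem mk_eqToHom_comp {w : X} (x : Arrow X) (h : w = x.left) :
    Arrow.mk (eqToHom h ≫ x.hom) = x := by
  subst h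
  exact congrArg Arrow.mk (Category.id_comp x.hom)

namespace RangeFiber

variable {u : X}

/-- `G^u_u` acts on `G^u` by left translation. -/
instance : MulAction (Stabilizer u) (RangeFiber u) where
  smul t y := y.translate (show u ⟶ u from t)
  one_smul y := congrArg RangeFiber.mk (Category.id_comp y.hom)
  mul_smul s t y := congrArg RangeFiber.mk
    (Category.assoc (show u ⟶ u from s) (show u ⟶ u from t) y.hom)

theorem toArrow_smul (t : Stabilizer u) (y : RangeFiber u) :
    (t • y).toArrow = comp t.toArrow y.toArrow rfl :=
  congrArg (fun h => Arrow.mk ((show u ⟶ u from t) ≫ h)) (Category.id_comp y.hom).symm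

/-- The quotient `z y⁻¹` of two elements of `G^u` with the same source. -/
def div (z y : RangeFiber u) (h : z.target = y.target) : Stabilizer u :=
  z.hom ≫ eqToHom h ≫ Groupoid.inv y.hom

theorem div_smul (z y : RangeFiber u) (h : z.target = y.target) : div z y h • y = z := by
  obtain ⟨y⟩ := y
  obtain ⟨z⟩ := z
  cases h
  refine congrArg RangeFiber.mk ?_
  simp [div]

theorem smul_div (t : Stabilizer u) (y : RangeFiber u) : div (t • y) y rfl = t := by
  have h : ∀ s : u ⟶ u, (s ≫ y.hom) ≫ 𝟙 _ ≫ Groupoid.inv y.hom = s := by simp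
  exact h t

/-- The unit `u` as an element of `G^u`. -/
def unit (u : X) : RangeFiber u := ⟨𝟙 u⟩

theorem toArrow_smul_unit (t : Stabilizer u) : (t • unit u).toArrow = t.toArrow :=
  congrArg Arrow.mk (Category.comp_id (show u ⟶ u from t))

theorem mem_orbit_unit {y : RangeFiber u} (h : y.target = u) :
    y ∈ MulAction.orbit (Stabilizer u) (unit u) :=
  ⟨div y (unit u) h, div_smul y (unit u) h⟩

theorem continuous_toArrow [TopologicalSpace (Arrow X)] : Continuous (toArrow (u := u)) :=
  continuous_induced_dom

end RangeFiber

variable [TopologicalSpace X] [TopologicalSpace (Arrow X)] [TopologicalGroupoid X]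

theorem continuous_comp {Z : Type*} [TopologicalSpace Z] {a b : Z → Arrow X} (ha : Continuous a)
    (hb : Continuous b) (h : ∀ z, (a z).right = (b z).left) :
    Continuous fun z => comp (a z) (b z) (h z) := by
  have h1 : Continuous fun z => (ComposablePair.mk (a z).hom (eqToHom (h z) ≫ (b z).hom) :
      ComposablePair X) := by
    rw [continuous_induced_rng]
    exact ha.prodMk (hb.congr fun z => (mk_eqToHom_comp (b z) (h z)).symm)
  exact TopologicalGroupoid.continuous_mul.comp h1

theorem isClosedEmbedding_unit [T2Space (Arrow X)] :
    IsClosedEmbedding fun u : X => Arrow.mk (𝟙 u) :=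
  Function.LeftInverse.isClosedEmbedding (f := fun x : Arrow X => x.left) (fun _ => rfl)
    TopologicalGroupoid.continuous_range TopologicalGroupoid.continuous_unit

namespace RangeFiber

variable {u : X}

theorem isClosedEmbedding_toArrow [T2Space (Arrow X)] (u : X) :
    IsClosedEmbedding (toArrow (u := u)) := by
  have : T2Space X := isClosedEmbedding_unit.isEmbedding.t2Space
  refine ⟨⟨⟨rfl⟩, ?_⟩, ?_⟩
  · rintro ⟨y⟩ ⟨z⟩ h
    cases h
    rfl
  · have h : range (toArrow (u := u)) = {x : Arrow X | x.left = u} := by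
      ext x
      constructor
      · rintro ⟨y, rfl⟩
        rfl
      · obtain ⟨a, b, g, rfl⟩ := Arrow.mk_surjective x
        intro h
        change a = u at h
        subst h
        exact ⟨⟨g⟩, rfl⟩
    rw [h]
    exact isClosed_singleton.preimage TopologicalGroupoid.continuous_range

theorem continuous_target : Continuous fun y : RangeFiber u => y.target :=
  TopologicalGroupoid.continuous_source.comp continuous_toArrow

instance [T2Space (Arrow X)] : T2Space (RangeFiber u) :=
  (isClosedEmbedding_toArrow u).isEmbedding.t2Space

instance [T2Space (Arrow X)] [LocallyCompactSpace (Arrow X)] : LocallyCompactSpace (RangeFiber u) :=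
  (isClosedEmbedding_toArrow u).locallyCompactSpace

instance : ContinuousSMul (Stabilizer u) (RangeFiber u) where
  continuous_smul := by
    rw [continuous_induced_rng]
    refine (continuous_comp (a := fun p : Stabilizer u × RangeFiber u => p.1.toArrow)
      (b := fun p => p.2.toArrow) ((Stabilizer.isInducing_toArrow u).continuous.comp continuous_fst)
      (continuous_toArrow.comp continuous_snd) fun _ => rfl).congr fun p => ?_
    exact (toArrow_smul p.1 p.2).symm

/-- The action is proper: `t` is the quotient of `t • y` by `y`. -/
instance [T2Space (Arrow X)] [LocallyCompactSpace (Arrow X)] :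
    ProperSMul (Stabilizer u) (RangeFiber u) := by
  have : T2Space X := isClosedEmbedding_unit.isEmbedding.t2Space
  rw [MulAction.properSMul_iff_isCompact_setOfPred_inter_nonempty]
  intro U V hU hV
  let Q : Set (RangeFiber u × RangeFiber u) := (V ×ˢ U) ∩ {p | p.1.target = p.2.target}
  have hQ : IsCompact Q := (hV.prod hU).inter_right
    (isClosed_eq (continuous_target.comp continuous_fst) (continuous_target.comp continuous_snd))
  have : CompactSpace Q := isCompact_iff_compactSpace.1 hQ
  let q : Q → Stabilizer u := fun p => div p.1.1 p.1.2 p.2.2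
  have hq : Continuous q := by
    rw [continuous_induced_rng]
    refine (continuous_comp (a := fun p : Q => p.1.1.toArrow)
      (b := fun p : Q => Arrow.mk (Groupoid.inv p.1.2.toArrow.hom))
      (continuous_toArrow.comp (continuous_fst.comp continuous_subtype_val))
      (TopologicalGroupoid.continuous_inv.comp
        (continuous_toArrow.comp (continuous_snd.comp continuous_subtype_val)))
      fun p => p.2.2)
  convert isCompact_range hq using 1
  ext t
  constructor
  · rintro ⟨_, ⟨y, hy, rfl⟩, hz⟩
    exact ⟨⟨(t • y, y), ⟨hz, hy⟩, rfl⟩, smul_div t y⟩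
  · rintro ⟨⟨⟨z, y⟩, ⟨hz, hy⟩, h⟩, rfl⟩
    refine ⟨z, ⟨y, hy, ?_⟩, hz⟩
    exact div_smul z y h

end RangeFiber

end TopGroupoid

/-! ### Haar measures of stabilizers as limits -/

/-- Cut-off functions on `X × X` which are `1` on the diagonal and whose supports shrink to it. -/
theorem exists_seq_diagonal_cutoff (X : Type*) [TopologicalSpace X]
    [TopologicalSpace.MetrizableSpace X] :
    ∃ ψ : ℕ → X × X → ℝ≥0, (∀ n, Continuous (ψ n)) ∧ (∀ n p, ψ n p ≤ 1) ∧
      (∀ n u, ψ n (u, u) = 1) ∧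
      ∀ (u : X) (K : Set X), IsCompact K → u ∉ K → ∀ᶠ n in atTop, ∀ v ∈ K, ψ n (u, v) = 0 := by
  let _ := TopologicalSpace.metrizableSpaceMetric X
  refine ⟨fun n p => 1 - n * nndist p.1 p.2, fun n => by fun_prop, fun n p => tsub_le_self,
    fun n u => by simp, fun u K hK hu => ?_⟩
  obtain ⟨ε, hε, hεK⟩ := Metric.isOpen_iff.1 hK.isClosed.isOpen_compl u hu
  obtain ⟨N, hN⟩ := exists_nat_ge (1 / ε)
  filter_upwards [eventually_ge_atTop N] with n hn v hv
  have h1 : ε ≤ dist u v := by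
    by_contra hcon
    exact hεK (by simpa [dist_comm] using hcon) hv
  refine tsub_eq_zero_of_le ?_
  rw [← NNReal.coe_le_coe]
  push_cast
  have h2 : 1 / ε ≤ n := hN.trans (by exact_mod_cast hn)
  rw [div_le_iff₀ hε] at h2
  exact h2.trans (mul_le_mul_of_nonneg_left h1 (by positivity))

namespace TopGroupoid

universe v u

variable {X : Type u} [Groupoid.{v} X] [TopologicalSpace X] [TopologicalSpace (Arrow X)]

namespace HaarSystem

variable (lam : HaarSystem X) {u : X}

instance : IsFiniteMeasureOnCompacts (lam.measure u) := lam.finite_on_compacts u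

instance : (lam.measure u).IsOpenPosMeasure := lam.full_support u

theorem continuous_integral_real {f : Arrow X → ℝ} (hf : Continuous f)
    (hfs : HasCompactSupport f) :
    Continuous fun u => ∫ y, f y.toArrow ∂(lam.measure u) := by
  have h := lam.continuous_integral ⟨⟨fun x => (f x : ℂ), by fun_prop⟩,
    hfs.comp_left Complex.ofReal_zero⟩
  refine (Complex.continuous_re.comp h).congr fun u => ?_
  change (∫ y : RangeFiber u, (f y.toArrow : ℂ) ∂(lam.measure u)).re = _
  rw [integral_complex_ofReal, Complex.ofReal_re]

/-- The Haar measure on `G^u` with a weight depending on the source only. -/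
noncomputable def weighted (w : X → ℝ≥0) (u : X) : Measure (RangeFiber u) :=
  (lam.measure u).withDensity fun y => w y.target

variable {w : X → ℝ≥0}

variable [TopologicalGroupoid X]

theorem integral_weighted (hw : Continuous w) (f : RangeFiber u → ℝ) :
    ∫ y, f y ∂(lam.weighted w u) = ∫ y, w y.target * f y ∂(lam.measure u) :=
  integral_withDensity_eq_integral_smul
    (hw.comp RangeFiber.continuous_target).measurable f

variable [T2Space (Arrow X)]

theorem isFiniteMeasureOnCompacts_weighted (hw1 : ∀ v, w v ≤ 1) :
    IsFiniteMeasureOnCompacts (lam.weighted w u) where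
  lt_top_of_isCompact K hK := by
    rw [weighted, withDensity_apply _ hK.measurableSet]
    calc ∫⁻ y in K, w y.target ∂(lam.measure u) ≤ ∫⁻ y in K, 1 ∂(lam.measure u) :=
          lintegral_mono fun y => ENNReal.coe_le_one_iff.2 (hw1 _)
      _ = lam.measure u K := setLIntegral_one K
      _ < ⊤ := hK.measure_lt_top

/-- Weights concentrating near `u` make the weighted measures concentrate on the stabilizer. -/
theorem concentratesOn_weighted [T2Space X] {ι : Type*} {l : Filter ι} {w : ι → X → ℝ≥0}
    (hw : ∀ K : Set X, IsCompact K → u ∉ K → ∀ᶠ i in l, ∀ v ∈ K, w i v = 0) :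
    ConcentratesOn (fun i => lam.weighted (w i) u) l
      (MulAction.orbit (Stabilizer u) (RangeFiber.unit u)) := by
  intro K hK hdisj
  refine (hw _ (hK.image RangeFiber.continuous_target) ?_).mono fun i hi => ?_
  · rintro ⟨y, hy, hyu⟩
    exact Set.disjoint_left.1 hdisj hy (RangeFiber.mem_orbit_unit hyu)
  · change lam.weighted (w i) u K = 0
    rw [weighted, withDensity_apply _ hK.measurableSet]
    rw [setLIntegral_congr_fun (g := 0) hK.measurableSet fun y hy => by
      simp [hi _ (mem_image_of_mem _ hy)]]
    simp

variable [SecondCountableTopology (Arrow X)] [LocallyCompactSpace (Arrow X)]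

/-- The measure `lam.measure u` itself is invariant under the stabilizer: the images in `G` of
this measure and of its translates have the same integrals. -/
instance : SMulInvariantMeasure (Stabilizer u) (RangeFiber u) (lam.measure u) where
  measure_preimage_smul t s hs := by
    borelize (Arrow X)
    have hi := RangeFiber.isClosedEmbedding_toArrow u
    have hti : IsClosedEmbedding fun y : RangeFiber u => (t • y).toArrow :=
      hi.comp (Homeomorph.smul t).isClosedEmbedding
    have hreg : ∀ {j : RangeFiber u → Arrow X}, IsClosedEmbedding j →
        ((lam.measure u).map j).Regular := by
      intro j hj
      have : IsFiniteMeasureOnCompacts ((lam.measure u).map j) := ⟨fun K hK => by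
        rw [Measure.map_apply hj.continuous.measurable hK.measurableSet]
        exact (hj.isCompact_preimage hK).measure_lt_top⟩
      have := isLocallyFiniteMeasure_of_isFiniteMeasureOnCompacts
        (μ := (lam.measure u).map j)
      infer_instance
    have := hreg hi
    have := hreg hti
    have hmap : (lam.measure u).map (fun y : RangeFiber u => (t • y).toArrow) =
        (lam.measure u).map RangeFiber.toArrow := by
      refine Measure.ext_of_integral_eq_on_compactlySupported fun f => ?_
      rw [integral_map hti.continuous.aemeasurable (map_continuous f).aestronglyMeasurable,
        integral_map hi.continuous.aemeasurable (map_continuous f).aestronglyMeasurable]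
      have h := lam.left_invariant ⟨⟨fun x => (f x : ℂ), by fun_prop⟩,
        f.hasCompactSupport.comp_left Complex.ofReal_zero⟩ (show u ⟶ u from t)
      have h' := congrArg Complex.re h
      change (∫ y : RangeFiber u, (f (t • y).toArrow : ℂ) ∂(lam.measure u)).re =
        (∫ y : RangeFiber u, (f y.toArrow : ℂ) ∂(lam.measure u)).re at h'
      rwa [integral_complex_ofReal, integral_complex_ofReal, Complex.ofReal_re,
        Complex.ofReal_re] at h'
    have h := congrArg (fun μ => μ (RangeFiber.toArrow '' s)) hmap
    have hs' : MeasurableSet (RangeFiber.toArrow '' s) :=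
      hi.measurableEmbedding.measurableSet_image.2 hs
    simp only [Measure.map_apply hti.continuous.measurable hs',
      Measure.map_apply hi.continuous.measurable hs'] at h
    rw [preimage_image_eq _ hi.injective] at h
    rw [← h]
    congr 1
    ext y
    change t • y ∈ s ↔ (t • y).toArrow ∈ RangeFiber.toArrow '' s
    exact hi.injective.mem_set_image.symm

/-- The weight is invariant because `t • y` has the same source as `y`. -/
theorem smulInvariantMeasure_weighted :
    SMulInvariantMeasure (Stabilizer u) (RangeFiber u) (lam.weighted w u) where
  measure_preimage_smul t s hs := by
    have hts : MeasurableSet ((fun y : RangeFiber u => t • y) ⁻¹' s) :=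
      (continuous_const_smul t).measurable hs
    rw [weighted, withDensity_apply _ hts, withDensity_apply _ hs, ← lintegral_indicator hts,
      ← lintegral_indicator hs]
    have h := (measurePreserving_smul t (lam.measure u)).lintegral_comp_emb
      (Homeomorph.smul t).measurableEmbedding (s.indicator fun y => (w y.target : ENNReal))
    rw [← h]
    rfl

/-- The ratio of two Haar integrals over `G^u_u` is a limit of ratios of functions which are
continuous in `u`. -/
theorem exists_tendsto_integral_stabilizer_div (lam : HaarSystem X) :
    ∃ A : ℕ → (Arrow X → ℝ) → X → ℝ,
      (∀ n f, Continuous f → HasCompactSupport f → Continuous (A n f)) ∧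
      ∀ f g : Arrow X → ℝ, Continuous f → HasCompactSupport f → Continuous g →
        HasCompactSupport g → (∀ x, 0 ≤ g x) → ∀ u : X, 0 < g (Arrow.mk (𝟙 u)) →
        ∀ β : Measure (Stabilizer u), β.IsHaarMeasure →
        Tendsto (fun n => A n f u / A n g u) atTop
          (𝓝 ((∫ t, f t.toArrow ∂β) / ∫ t, g t.toArrow ∂β)) := by
  have hX := isClosedEmbedding_unit (X := X)
  have : T2Space X := hX.isEmbedding.t2Space
  have : SecondCountableTopology X := hX.isEmbedding.secondCountableTopology
  have : LocallyCompactSpace X := hX.locallyCompactSpace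
  have : TopologicalSpace.MetrizableSpace X :=
    TopologicalSpace.metrizableSpace_of_t3_secondCountable X
  obtain ⟨ψ, hψ, hψ1, hψd, hψ0⟩ := exists_seq_diagonal_cutoff X
  refine ⟨fun n f u => ∫ y : RangeFiber u, ψ n (u, y.target) * f y.toArrow ∂(lam.measure u),
    fun n f hf hfs => ?_, fun f g hf hfs hg hgs hg0 u hgu β hβ => ?_⟩
  · have hF : Continuous fun x : Arrow X => (ψ n (x.left, x.right) : ℝ) * f x :=
      (NNReal.continuous_coe.comp ((hψ n).comp (TopologicalGroupoid.continuous_range.prodMk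
        TopologicalGroupoid.continuous_source))).mul hf
    exact lam.continuous_integral_real hF hfs.mul_left
  · have hi := RangeFiber.isClosedEmbedding_toArrow u
    let w : ℕ → X → ℝ≥0 := fun n v => ψ n (u, v)
    have hw : ∀ n, Continuous (w n) := fun n => (hψ n).comp (by fun_prop)
    have := fun n => lam.isFiniteMeasureOnCompacts_weighted (u := u) (w := w n) fun v => hψ1 n _
    have := fun n => lam.smulInvariantMeasure_weighted (u := u) (w := w n)
    have hconc := lam.concentratesOn_weighted (hψ0 u)
    have hpos : ∀ n, 0 < ∫ y : RangeFiber u, g y.toArrow ∂(lam.weighted (w n) u) := by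
      intro n
      rw [lam.integral_weighted (hw n)]
      refine Continuous.integral_pos_of_hasCompactSupport_nonneg_nonzero
        (x := RangeFiber.unit u) ?_ ?_ ?_ ?_
      · exact (NNReal.continuous_coe.comp ((hw n).comp RangeFiber.continuous_target)).mul
          (hg.comp hi.continuous)
      · exact (hgs.comp_isClosedEmbedding hi).mul_left
      · exact fun y => mul_nonneg (NNReal.coe_nonneg _) (hg0 _)
      · have h1 : w n (RangeFiber.unit u).target = 1 := hψd n u
        rw [h1]
        simpa using (show g (RangeFiber.unit u).toArrow ≠ 0 from hgu.ne')
    have lim := ConcentratesOn.tendsto_integral_div hconc β (hf.comp hi.continuous)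
      (hfs.comp_isClosedEmbedding hi) (hg.comp hi.continuous) (hgs.comp_isClosedEmbedding hi)
      (fun y => hg0 _) hgu (.of_forall hpos)
    simp only [Function.comp_apply, RangeFiber.toArrow_smul_unit] at lim
    refine lim.congr fun n => ?_
    rw [lam.integral_weighted (hw n), lam.integral_weighted (hw n)]

end HaarSystem

end TopGroupoid

/-! ### Normalized Haar measures and the modular function -/

theorem exists_seq_continuous_hasCompactSupport_pos (G : Type*) [TopologicalSpace G] [T2Space G]
    [LocallyCompactSpace G] [SecondCountableTopology G] :
    ∃ g : ℕ → G → ℝ, (∀ n, Continuous (g n)) ∧ (∀ n, HasCompactSupport (g n)) ∧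
      (∀ n x, 0 ≤ g n x) ∧ ∀ x, ∃ n, 0 < g n x := by
  choose g hg1 _ hgs hgI using fun n => exists_continuous_one_zero_of_isCompact
    (isCompact_compactCovering G n) isClosed_empty (disjoint_empty _)
  refine ⟨fun n => g n, fun n => (g n).continuous, hgs, fun n x => (hgI n x).1, fun x => ?_⟩
  obtain ⟨n, hn⟩ := exists_mem_compactCovering x
  exact ⟨n, by simp [hg1 n hn]⟩

namespace TopGroupoid

universe v u

variable {X : Type u} [Groupoid.{v} X] [TopologicalSpace X] [TopologicalSpace (Arrow X)]
  [TopologicalGroupoid X] [SecondCountableTopology (Arrow X)]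
  [LocallyCompactSpace (Arrow X)] [T2Space (Arrow X)] [MeasurableSpace X] [BorelSpace X]

/-- Haar measures of the stabilizers, normalized by the first of a sequence of functions `g n`
which is positive at the unit `u`, form a measurable family: their integrals are pointwise limits
of Borel functions. `N u` is the index of the function used at `u`. -/
theorem HaarSystem.exists_measurable_haar (lam : HaarSystem X) [MeasurableSpace (Arrow X)]
    [BorelSpace (Arrow X)] :
    ∃ β : ∀ u : X, Measure (Stabilizer u), (∀ u, (β u).IsHaarMeasure) ∧
      Measurable (fun u => (β u).map Stabilizer.toArrow) ∧
      ∃ (g : ℕ → Arrow X → ℝ) (N : X → ℕ), (∀ n, Continuous (g n)) ∧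
        (∀ n, HasCompactSupport (g n)) ∧ Measurable N ∧
        ∀ u, ∫ t, g (N u) t.toArrow ∂(β u) = 1 := by
  classical
  obtain ⟨A, hA, hlim⟩ := lam.exists_tendsto_integral_stabilizer_div
  obtain ⟨g, hg, hgs, hg0, hgpos⟩ := exists_seq_continuous_hasCompactSupport_pos (Arrow X)
  have hex : ∀ u : X, ∃ n, 0 < g n (Arrow.mk (𝟙 u)) := fun u => hgpos _
  have hset : ∀ n, MeasurableSet {u : X | 0 < g n (Arrow.mk (𝟙 u))} := fun n =>
    (isOpen_lt continuous_const
      ((hg n).comp TopologicalGroupoid.continuous_unit)).measurableSet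
  let N : X → ℕ := fun u => Nat.find (hex u)
  have hN : ∀ u : X, 0 < g (N u) (Arrow.mk (𝟙 u)) := fun u => Nat.find_spec (hex u)
  let c : X → ℝ := fun u => ∫ t : Stabilizer u, g (N u) t.toArrow ∂Measure.haar
  have hc : ∀ u, 0 < c u := by
    intro u
    have hi := Stabilizer.isClosedEmbedding_toArrow u
    refine ((hg _).comp hi.continuous).integral_pos_of_hasCompactSupport_nonneg_nonzero (x := 1)
      ((hgs _).comp_isClosedEmbedding hi) (fun t => hg0 _ _) ?_
    exact (hN u).ne'
  let β : ∀ u : X, Measure (Stabilizer u) := fun u => ENNReal.ofReal (c u)⁻¹ • Measure.haar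
  have hβ : ∀ u, (β u).IsHaarMeasure := fun u => Measure.IsHaarMeasure.smul _
    (by simpa using hc u) ENNReal.ofReal_ne_top
  have hint : ∀ (u : X) (f : Stabilizer u → ℝ),
      ∫ t, f t ∂(β u) = (∫ t, f t ∂Measure.haar) / c u := by
    intro u f
    rw [integral_smul_measure, ENNReal.toReal_ofReal (inv_nonneg.2 (hc u).le), smul_eq_mul,
      div_eq_inv_mul]
  refine ⟨β, hβ, ?_, g, N, hg, hgs, measurable_find hex hset, fun u => ?_⟩
  · refine Measure.measurable_of_measurable_integral (fun u => ⟨fun K hK => ?_⟩)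
      fun f hf hfs _ => ?_
    · have hi := Stabilizer.isClosedEmbedding_toArrow u
      rw [Measure.map_apply hi.continuous.measurable hK.measurableSet]
      exact (hi.isCompact_preimage hK).measure_lt_top
    · refine measurable_of_tendsto_metrizable
        (f := fun k u => A k f u / A k (g (N u)) u) (fun k => ?_) (tendsto_pi_nhds.2 fun u => ?_)
      · exact (hA k f hf hfs).measurable.div (Measurable.find
          (f := fun n u => A k (g n) u) (fun n => (hA k _ (hg n) (hgs n)).measurable) hset hex)
      · have hi := Stabilizer.isClosedEmbedding_toArrow u
        rw [integral_map hi.continuous.aemeasurable hf.aestronglyMeasurable, hint]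
        exact hlim f (g (N u)) hf hfs (hg _) (hgs _) (hg0 _) u (hN u) Measure.haar inferInstance
  · rw [hint]
    exact div_self (hc u).ne'

/-- The modular character of the stabilizers is the restriction of a Borel function on `G`: with
the normalization `∫ g dβ^u = 1`, its value at `t` is `∫ g(st) dβ^u(s)`. -/
theorem HaarSystem.exists_measurable_haar_modularCharacter (lam : HaarSystem X)
    [MeasurableSpace (Arrow X)] [BorelSpace (Arrow X)] :
    ∃ β : ∀ u : X, Measure (Stabilizer u), (∀ u, (β u).IsHaarMeasure) ∧
      Measurable (fun u => (β u).map Stabilizer.toArrow) ∧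
      ∃ D : Arrow X → ℝ, Measurable D ∧
        ∀ (u : X) (t : Stabilizer u), D t.toArrow = Measure.modularCharacter t := by
  classical
  obtain ⟨β, hβ, hmeas, g, N, hg, hgs, hN, hnorm⟩ := lam.exists_measurable_haar
  have hX := isClosedEmbedding_unit (X := X)
  have : T2Space X := hX.isEmbedding.t2Space
  let κ : ProbabilityTheory.Kernel X (Arrow X) := ⟨_, hmeas⟩
  have hκ : ∀ u, κ u = (β u).map Stabilizer.toArrow := fun u => rfl
  have : ProbabilityTheory.IsSFiniteKernel κ := by
    refine ProbabilityTheory.Kernel.isSFiniteKernel_of_isFiniteMeasureOnCompacts κ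
      fun u => ⟨fun K hK => ?_⟩
    have hi := Stabilizer.isClosedEmbedding_toArrow u
    rw [hκ, Measure.map_apply hi.continuous.measurable hK.measurableSet]
    exact (hi.isCompact_preimage hK).measure_lt_top
  -- The function `(y, x) ↦ g (x y)`, extended by `0` to pairs which are not composable.
  let P : Set (Arrow X × Arrow X) := {p | p.2.right = p.1.left}
  have hP : MeasurableSet P := (isClosed_eq
    (TopologicalGroupoid.continuous_source.comp continuous_snd)
    (TopologicalGroupoid.continuous_range.comp continuous_fst)).measurableSet
  let k : ℕ → Arrow X × Arrow X → ℝ := fun n p =>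
    if h : p ∈ P then g n (comp p.2 p.1 h) else 0
  have hk : ∀ n, Measurable (k n) := fun n => Measurable.dite
    ((hg n).comp (continuous_comp (a := fun p : P => p.1.2) (b := fun p : P => p.1.1)
      (continuous_snd.comp continuous_subtype_val) (continuous_fst.comp continuous_subtype_val)
      fun p => p.2)).measurable
    measurable_const hP
  let F : Arrow X × Arrow X → ℝ := fun p => k (N p.1.left) p
  have hF : Measurable F := by
    have h1 : Measurable fun q : (Arrow X × Arrow X) × ℕ => k q.2 q.1 :=
      measurable_from_prod_countable_left hk
    exact h1.comp (measurable_id.prodMk (hN.comp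
      (TopologicalGroupoid.continuous_range.measurable.comp measurable_fst)))
  let η := κ.comap (fun y : Arrow X => y.left) TopologicalGroupoid.continuous_range.measurable
  refine ⟨β, hβ, hmeas, fun y => ∫ x, F (y, x) ∂(η y),
    (hF.stronglyMeasurable.integral_kernel_prod_right' (κ := η)).measurable, fun u t => ?_⟩
  have hi := Stabilizer.isClosedEmbedding_toArrow u
  have h1 : ∫ x, F (t.toArrow, x) ∂(η t.toArrow) =
      ∫ s : Stabilizer u, g (N u) (s * t).toArrow ∂(β u) := by
    change ∫ x, F (t.toArrow, x) ∂((β u).map Stabilizer.toArrow) = _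
    rw [hi.measurableEmbedding.integral_map]
    refine integral_congr_ae (.of_forall fun s => ?_)
    have hs : (t.toArrow, s.toArrow) ∈ P := rfl
    change k (N u) (t.toArrow, s.toArrow) = _
    simp only [k, dif_pos hs]
    refine congrArg (g (N u)) ?_
    exact congrArg (fun h => Arrow.mk ((show u ⟶ u from s) ≫ h))
      (Category.id_comp (show u ⟶ u from t))
  have h2 := integral_mul_right_eq_modularCharacter_mul (β u) ((hg (N u)).comp hi.continuous)
    ((hgs (N u)).comp_isClosedEmbedding hi) t
  simp only [Function.comp_apply, hnorm, mul_one] at h2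
  exact h1.trans h2

end TopGroupoid

theorem mainTheorem4 {X : Type*} [Groupoid X]
    [TopologicalSpace X] [TopologicalSpace (Arrow X)] [TopologicalGroupoid X]
    [SecondCountableTopology (Arrow X)] [LocallyCompactSpace (Arrow X)] [T2Space (Arrow X)]
    [MeasurableSpace X] [BorelSpace X] (lam : HaarSystem X) :
    ∃ β : ∀ u : X, Measure (Stabilizer u),
      (∀ u, (β u).IsHaarMeasure) ∧
      ∀ f : C_c(Arrow X, ℂ), Measurable fun u : X =>
        ∫ t : Stabilizer u, f t.toArrow * ((modularFunction t ^ (-(1 / 2) : ℝ) : ℝ) : ℂ) ∂(β u) := by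
  borelize (Arrow X)
  obtain ⟨β, hβ, hmeas, D, hD, hDt⟩ := lam.exists_measurable_haar_modularCharacter
  refine ⟨β, hβ, fun f => ?_⟩
  let κ : ProbabilityTheory.Kernel X (Arrow X) := ⟨_, hmeas⟩
  have hF : Measurable fun x => f x * ((((D x)⁻¹ ^ (-(1 / 2) : ℝ) : ℝ)) : ℂ) :=
    (map_continuous f).measurable.mul
      (Complex.measurable_ofReal.comp (hD.inv.pow_const _))
  have h := (hF.stronglyMeasurable.integral_kernel (κ := κ)).measurable
  convert h using 2 with u
  have hi := Stabilizer.isClosedEmbedding_toArrow u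
  change _ = ∫ x, _ ∂((β u).map Stabilizer.toArrow)
  rw [hi.measurableEmbedding.integral_map]
  simp only [hDt, modularFunction]
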